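/- Theorem. Consider a set of $n$ products with unit prices $r_i \ge 0$ and starting inventory $c\in\mathbb{Z}_{\ge 0}^n$, a deterministic number $T$ of customers arriving one after another, and $m$ customer types. Customer $t$ is, independently of everything else, of type $k$ with known probability $\lambda_{k,t}$ ($\sum_k\lambda_{k,t}=1$ for every $t$); let $\lambda_k=\frac1T\sum_{t=1}^T\lambda_{k,t}$, so that $T\lambda_k$ is the expected number of customers of type $k$. A customer of type $k$ who is offered the assortment $S\subseteq N=\{1,\dots,n\}$ buys one unit of product $i$ with probability $\phi_k(i,S)$ and nothing with the remaining probability, where $\phi_k(i,S)\ge 0$, $\phi_k(i,S)=0$ for $i\notin S$, and $\sum_{i\in S}\phi_k(i,S)\le 1$. Assume that every $\phi_k$ satisfies weak substitutability: $\phi_k(i,S')\le\phi_k(i,S)$ whenever $i\in S\subseteq S'\subseteq N$. Write $R_k(S)=\sum_{i\in S}r_i\phi_k(i,S)$, and let $$f^{M}_{LP}(c,T)=\max_{y\ge 0}\Big\{\,T\sum_{k}\lambda_k\sum_{S\subseteq N}y_k(S)R_k(S)\ :\ T\sum_k\lambda_k\sum_{S\subseteq N}y_k(S)\phi_k(i,S)\le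 c_i\ \ \forall i\in N,\ \ \sum_{S\subseteq N}y_k(S)=1\ \ \forall k\Big\}$$ be the optimal value of the multi-type choice-based linear program (CDLP). Then an optimal solution exists, and for every optimal solution $y$ the following holds. Let $f(c,T)$ be the expected total revenue of the policy that, when customer $t$ arrives and is of type $k$, samples an assortment $S_t$ with $\Pr(S_t=S)=y_k(S)$ (independently of the past) and offers $S_t\cap N_t$, where $N_t$ is the set of products that still have at least one unit of inventory left. Then $$f(c,T)\ \ge\ \Big(1-\frac1e\Big)\,f^{M}_{LP}(c,T).$$ -/

import Mathlib

open scoped Finset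

/-- A choice model on the products `Fin n`: `prob i S` is the probability that a customer who is
offered the assortment `S` buys product `i`.  The remaining mass `1 - ∑ i, prob i S` is the
probability that the customer buys nothing. -/
structure ChoiceModel (n : ℕ) where
  prob : Fin n → Finset (Fin n) → ℝ
  prob_nonneg : ∀ i S, 0 ≤ prob i S
  prob_eq_zero : ∀ i S, i ∉ S → prob i S = 0
  sum_prob_le_one : ∀ S, ∑ i, prob i S ≤ 1

namespace ChoiceModel

variable {n : ℕ}

/-- Weak substitutability: enlarging the assortment never increases the purchase probability of a
product that was already offered. -/
def WeaklySubstitutable (φ : ChoiceModel n) : Prop :=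
  ∀ (S S' : Finset (Fin n)) (i : Fin n), S ⊆ S' → i ∈ S → φ.prob i S' ≤ φ.prob i S

/-- Probability of each outcome of the choice from the assortment `S`: `some i` is a purchase of
product `i`, and `none` is no purchase. -/
def outcomeProb (φ : ChoiceModel n) (S : Finset (Fin n)) : Option (Fin n) → ℝ
  | some i => φ.prob i S
  | none => 1 - ∑ i, φ.prob i S

/-- Expected revenue from one customer who is offered the assortment `S`, at prices `r`. -/
def expRevenue (φ : ChoiceModel n) (r : Fin n → ℝ) (S : Finset (Fin n)) : ℝ :=
  ∑ i ∈ S, r i * φ.prob i S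

end ChoiceModel

/-- The dynamic assortment problem with personalization, for `n` products, `m` customer types and a
deterministic number `T` of customers: prices, starting inventory, the probability
`typeProb t k` that customer `t` is of type `k`, and one choice model for each type. -/
structure PersonalizedAssortmentProblem (n m T : ℕ) where
  price : Fin n → ℝ
  price_nonneg : ∀ i, 0 ≤ price i
  inventory : Fin n → ℕ
  typeProb : Fin T → Fin m → ℝ
  typeProb_nonneg : ∀ t k, 0 ≤ typeProb t k
  sum_typeProb : ∀ t, ∑ k, typeProb t k = 1
  choice : Fin m → ChoiceModel n

namespace PersonalizedAssortmentProblem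

noncomputable section

variable {n m T : ℕ}

/-- The average `λ_k` over the customers `t` of the probability that customer `t` is of type `k`,
so that `T * λ_k` is the expected number of customers of type `k`. -/
def avgTypeProb (P : PersonalizedAssortmentProblem n m T) (k : Fin m) : ℝ :=
  (∑ t, P.typeProb t k) / T

/-! ### The multi-type choice-based linear program; `y k S` is the probability with which
assortment `S` is offered to a customer of type `k`. -/

/-- Feasible solutions of the multi-type CDLP. -/
structure CDLPFeasible (P : PersonalizedAssortmentProblem n m T)
    (y : Fin m → Finset (Fin n) → ℝ) : Prop where
  nonneg : ∀ k S, 0 ≤ y k S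
  sum_eq_one : ∀ k, ∑ S, y k S = 1
  inventory_le : ∀ i,
    (T : ℝ) * ∑ k, P.avgTypeProb k * ∑ S, y k S * (P.choice k).prob i S ≤ P.inventory i

/-- Objective function of the multi-type CDLP. -/
def cdlpObjective (P : PersonalizedAssortmentProblem n m T)
    (y : Fin m → Finset (Fin n) → ℝ) : ℝ :=
  (T : ℝ) * ∑ k, P.avgTypeProb k * ∑ S, y k S * (P.choice k).expRevenue P.price S

/-- Optimal solutions of the multi-type CDLP. -/
def CDLPOptimal (P : PersonalizedAssortmentProblem n m T)
    (y : Fin m → Finset (Fin n) → ℝ) : Prop :=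
  P.CDLPFeasible y ∧ ∀ y', P.CDLPFeasible y' → P.cdlpObjective y' ≤ P.cdlpObjective y

/-- The optimal value of the multi-type CDLP. -/
def cdlpValue (P : PersonalizedAssortmentProblem n m T) : ℝ :=
  sSup {v | ∃ y, P.CDLPFeasible y ∧ P.cdlpObjective y = v}

/-! ### The policy that samples an assortment and intersects it with the available products -/

/-- What happens with one customer: the type, the sampled assortment (before the intersection with
the available products), and the purchase (`none` for no purchase). -/
abbrev CustomerRecord (n m : ℕ) := Fin m × Finset (Fin n) × Option (Fin n)

/-- The products that are available to customer `t` on the sample path `ω`: those of which the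
customers before `t` have bought fewer units than the starting inventory. -/
def available (P : PersonalizedAssortmentProblem n m T) (ω : Fin T → CustomerRecord n m)
    (t : Fin T) : Finset (Fin n) :=
  {i | #{s : Fin T | s < t ∧ (ω s).2.2 = some i} < P.inventory i}

/-- Probability of the sample path `ω` under the policy.  Given the history, customer `t` is of
type `k` with probability `typeProb t k`, the assortment `S` is sampled with probability `y k S`,
and the purchase is made from `S ∩ available` according to the choice model of type `k`. -/
def pathProb (P : PersonalizedAssortmentProblem n m T) (y : Fin m → Finset (Fin n) → ℝ)
    (ω : Fin T → CustomerRecord n m) : ℝ :=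
  ∏ t, P.typeProb t (ω t).1 * y (ω t).1 (ω t).2.1 *
    (P.choice (ω t).1).outcomeProb ((ω t).2.1 ∩ P.available ω t) (ω t).2.2

/-- Expected number of units of product `i` that are sold under the policy. -/
def expSales (P : PersonalizedAssortmentProblem n m T) (y : Fin m → Finset (Fin n) → ℝ)
    (i : Fin n) : ℝ :=
  ∑ ω : Fin T → CustomerRecord n m, P.pathProb y ω * #{t : Fin T | (ω t).2.2 = some i}

/-- Expected total revenue of the policy. -/
def expRevenue (P : PersonalizedAssortmentProblem n m T) (y : Fin m → Finset (Fin n) → ℝ) : ℝ :=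
  ∑ i, P.price i * P.expSales y i

end

end PersonalizedAssortmentProblem

/-! Fix a product `i` and let `p t` be the probability that customer `t` buys it when stock is
ignored. The LP constraint says `∑ t, p t ≤ c i`, and the objective is the sum of `r i * ∑ t, p t`.
Removing other sold-out products can only raise the purchase probability of `i`, so while `i` is in
stock, it sells to customer `t` with conditional probability at least `p t`, whatever the history.

Induction over the customers then bounds expected sales below by `E[min(D, c i)]` with `D` Poisson
of mean `∑ t, p t` (`poissonMin_le_sum_pathWeight`). The Poisson comparison sees only the total of
the `p t`, so heterogeneity over time and types disappears. Concavity in the mean and the value at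
mean `c i` give the factor `1 - 1/e` (`le_poissonMin`). An optimal solution exists by compactness.
-/

/-! ### The truncated mean of the Poisson distribution -/

/-- The probability that a Poisson variable of mean `x` is less than `c`. -/
noncomputable def poissonLt (c : ℕ) (x : ℝ) : ℝ :=
  ∑ j ∈ Finset.range c, Real.exp (-x) * (x ^ j / j.factorial)

/-- The expectation of `min D c` for a Poisson variable `D` of mean `x`, as the sum over `b < c` of
the probability of `b < D`. -/
noncomputable def poissonMin (c : ℕ) (x : ℝ) : ℝ :=
  ∑ b ∈ Finset.range c, (1 - poissonLt (b + 1) x)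

theorem poissonLt_succ (c : ℕ) (x : ℝ) :
    poissonLt (c + 1) x = poissonLt c x + Real.exp (-x) * (x ^ c / c.factorial) :=
  Finset.sum_range_succ _ _

theorem poissonMin_succ (c : ℕ) (x : ℝ) :
    poissonMin (c + 1) x = poissonMin c x + (1 - poissonLt (c + 1) x) :=
  Finset.sum_range_succ _ _

theorem poissonLt_nonneg (c : ℕ) {x : ℝ} (hx : 0 ≤ x) : 0 ≤ poissonLt c x :=
  Finset.sum_nonneg fun _ _ => by positivity

theorem poissonLt_succ_zero (c : ℕ) : poissonLt (c + 1) 0 = 1 := by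
  induction c with
  | zero => simp [poissonLt]
  | succ c ih => rw [poissonLt_succ, ih]; simp

theorem poissonMin_zero (c : ℕ) : poissonMin c 0 = 0 := by
  simp [poissonMin, poissonLt_succ_zero]

theorem hasDerivAt_poissonLt_succ (c : ℕ) (x : ℝ) :
    HasDerivAt (poissonLt (c + 1)) (-(Real.exp (-x) * (x ^ c / c.factorial))) x := by
  have hexp : HasDerivAt (fun x : ℝ => Real.exp (-x)) (-Real.exp (-x)) x := by
    simpa using (hasDerivAt_neg x).exp
  induction c with
  | zero =>
    have h : poissonLt (0 + 1) = fun x => Real.exp (-x) := by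
      funext x; simp [poissonLt]
    rw [h]
    simpa using hexp
  | succ c ih =>
    have h : poissonLt (c + 1 + 1) = fun x =>
        poissonLt (c + 1) x + Real.exp (-x) * (x ^ (c + 1) / (c + 1).factorial) := by
      funext x; exact poissonLt_succ _ _
    rw [h]
    refine (ih.add (hexp.mul ((hasDerivAt_pow (c + 1) x).div_const
      ((c + 1).factorial : ℝ)))).congr_deriv ?_
    have h1 : ((c + 1 : ℕ) : ℝ) * x ^ (c + 1 - 1) / ((c + 1).factorial : ℝ)
        = x ^ c / c.factorial := by
      rw [Nat.factorial_succ]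
      have : (c.factorial : ℝ) ≠ 0 := by positivity
      push_cast
      have : (c : ℝ) + 1 ≠ 0 := by positivity
      field_simp
    rw [h1]
    ring

/-- The derivative of `P(D > b)` in the mean is `P(D = b)`; summing over `b < c` gives `P(D < c)`.
-/
theorem hasDerivAt_poissonMin (c : ℕ) (x : ℝ) :
    HasDerivAt (poissonMin c) (poissonLt c x) x := by
  have h := HasDerivAt.fun_sum (u := Finset.range c) (x := x) fun b _ =>
    (hasDerivAt_poissonLt_succ b x).const_sub 1
  simp only [neg_neg] at h
  exact h

theorem antitoneOn_poissonLt (c : ℕ) : AntitoneOn (poissonLt c) (Set.Ici 0) := by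
  cases c with
  | zero => intro x _ y _ _; simp [poissonLt]
  | succ c =>
    refine antitoneOn_of_deriv_nonpos (convex_Ici 0)
      (fun x _ => (hasDerivAt_poissonLt_succ c x).continuousAt.continuousWithinAt)
      (fun x _ => (hasDerivAt_poissonLt_succ c x).differentiableAt.differentiableWithinAt)
      fun x hx => ?_
    rw [interior_Ici, Set.mem_Ioi] at hx
    rw [(hasDerivAt_poissonLt_succ c x).deriv, neg_nonpos]
    positivity

theorem concaveOn_poissonMin (c : ℕ) : ConcaveOn ℝ (Set.Ici 0) (poissonMin c) := by
  refine AntitoneOn.concaveOn_of_deriv (convex_Ici 0)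
    (fun x _ => (hasDerivAt_poissonMin c x).continuousAt.continuousWithinAt)
    (fun x _ => (hasDerivAt_poissonMin c x).differentiableAt.differentiableWithinAt) ?_
  have h : deriv (poissonMin c) = poissonLt c := funext fun x => (hasDerivAt_poissonMin c x).deriv
  rw [h]
  exact (antitoneOn_poissonLt c).mono interior_subset

/-- The tangent of the concave function `poissonMin c` at `x` lies above its graph. -/
theorem poissonMin_add_le (c : ℕ) {x p : ℝ} (hx : 0 ≤ x) (hp : 0 ≤ p) :
    poissonMin c (p + x) ≤ poissonMin c x + p * poissonLt c x := by
  have h := (convex_Ici x).image_sub_le_mul_sub_of_deriv_le (f := poissonMin c)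
    (C := poissonLt c x)
    (fun z _ => (hasDerivAt_poissonMin c z).continuousAt.continuousWithinAt)
    (fun z _ => (hasDerivAt_poissonMin c z).differentiableAt.differentiableWithinAt)
    (fun z hz => by
      rw [interior_Ici, Set.mem_Ioi] at hz
      rw [(hasDerivAt_poissonMin c z).deriv]
      exact antitoneOn_poissonLt c hx (hx.trans hz.le) hz.le)
    x Set.self_mem_Ici (p + x) (by simpa using hp) (by linarith)
  linarith [mul_comm p (poissonLt c x), show poissonLt c x * (p + x - x) = poissonLt c x * p by ring]

/-- Since `j * P(D = j) = x * P(D = j - 1)`, the part of the mean on `D ≤ c` is `x * P(D < c)`. -/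
theorem poissonMin_succ_eq (c : ℕ) (x : ℝ) :
    poissonMin (c + 1) x = x * poissonLt c x + (c + 1) * (1 - poissonLt (c + 1) x) := by
  induction c with
  | zero => simp [poissonMin, poissonLt]
  | succ c ih =>
    rw [poissonMin_succ, ih, poissonLt_succ (c + 1) x, poissonLt_succ c x, Nat.factorial_succ,
      pow_succ]
    have : (c.factorial : ℝ) ≠ 0 := by positivity
    have : (c : ℝ) + 1 ≠ 0 := by positivity
    push_cast
    field_simp
    ring

/-- Bounds `P(D = c)` by `1/e` at mean `c + 1`. The inductive step is `(1 + 1/(c+1))^(c+1) ≤ e`. -/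
theorem succ_pow_le_exp_mul_factorial (c : ℕ) :
    ((c : ℝ) + 1) ^ c ≤ Real.exp c * c.factorial := by
  induction c with
  | zero => simp
  | succ c ih =>
    have hc : (0 : ℝ) < c + 1 := by positivity
    have h1 : (1 + 1 / ((c : ℝ) + 1)) ^ (c + 1) ≤ Real.exp 1 := by
      calc (1 + 1 / ((c : ℝ) + 1)) ^ (c + 1) ≤ Real.exp (1 / ((c : ℝ) + 1)) ^ (c + 1) := by
            refine pow_le_pow_left₀ (by positivity) ?_ _
            rw [add_comm]
            exact Real.add_one_le_exp _
        _ = Real.exp 1 := by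
            rw [← Real.exp_nat_mul]
            congr 1
            push_cast
            field_simp
    have h2 : ((c + 1 : ℕ) : ℝ) + 1 = (c + 1) * (1 + 1 / ((c : ℝ) + 1)) := by
      push_cast
      field_simp
    rw [h2, mul_pow, Nat.factorial_succ]
    push_cast
    rw [Real.exp_add]
    calc ((c : ℝ) + 1) ^ (c + 1) * (1 + 1 / ((c : ℝ) + 1)) ^ (c + 1)
        ≤ ((Real.exp c * c.factorial) * (c + 1)) * Real.exp 1 := by
          rw [pow_succ (n := c) ((c : ℝ) + 1)]
          gcongr
      _ = _ := by ring

/-- A Poisson variable loses at most the fraction `1 / e` of its mean by truncation at an integer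
that is at least the mean. -/
theorem le_poissonMin (c : ℕ) {x : ℝ} (hx : 0 ≤ x) (hxc : x ≤ c) :
    (1 - 1 / Real.exp 1) * x ≤ poissonMin c x := by
  cases c with
  | zero =>
    obtain rfl : x = 0 := le_antisymm (by simpa using hxc) hx
    simp [poissonMin]
  | succ c =>
    push_cast at hxc
    have hc : (0 : ℝ) < c + 1 := by positivity
    -- At mean `c + 1` the truncated mean is exactly `(c + 1) * (1 - P(D = c))`.
    have h1 : (1 - 1 / Real.exp 1) * ((c : ℝ) + 1) ≤ poissonMin (c + 1) (c + 1) := by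
      have h2 : Real.exp (-((c : ℝ) + 1)) * (((c : ℝ) + 1) ^ c / c.factorial)
          ≤ 1 / Real.exp 1 := by
        have h3 : ((c : ℝ) + 1) ^ c / c.factorial ≤ Real.exp c := by
          rw [div_le_iff₀ (by positivity)]
          exact succ_pow_le_exp_mul_factorial c
        calc _ ≤ Real.exp (-((c : ℝ) + 1)) * Real.exp c := by gcongr
          _ = 1 / Real.exp 1 := by
            rw [← Real.exp_add, one_div, ← Real.exp_neg]
            congr 1
            ring
      rw [poissonMin_succ_eq, poissonLt_succ]
      nlinarith
    -- Smaller means: the graph lies above its chord from the origin to `c + 1`.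
    have h4 := (concaveOn_poissonMin (c + 1)).2 (show (0 : ℝ) ∈ Set.Ici 0 from Set.self_mem_Ici)
      (show (c : ℝ) + 1 ∈ Set.Ici 0 from hc.le)
      (show 0 ≤ 1 - x / ((c : ℝ) + 1) from sub_nonneg.2 ((div_le_one hc).2 hxc))
      (show 0 ≤ x / ((c : ℝ) + 1) by positivity) (by ring)
    simp only [smul_eq_mul, mul_zero, zero_add, poissonMin_zero] at h4
    rw [div_mul_cancel₀ _ hc.ne'] at h4
    calc (1 - 1 / Real.exp 1) * x = x / (c + 1) * ((1 - 1 / Real.exp 1) * (c + 1)) := by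
          field_simp
      _ ≤ x / (c + 1) * poissonMin (c + 1) (c + 1) := by gcongr
      _ ≤ _ := h4

/-- One step of the comparison with the Poisson distribution: a sale has probability `q ≥ p`. -/
theorem poissonMin_succ_add_le (c : ℕ) {x p q : ℝ} (hx : 0 ≤ x) (hp : 0 ≤ p) (hpq : p ≤ q) :
    poissonMin (c + 1) (p + x) ≤
      q * (1 + poissonMin c x) + (1 - q) * poissonMin (c + 1) x := by
  have h1 := poissonMin_add_le (c + 1) hx hp
  have h2 := poissonMin_succ c x
  have h3 := mul_le_mul_of_nonneg_right hpq (poissonLt_nonneg (c + 1) hx)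
  -- The net gain from a sale is `P(D < c + 1)`, which is also the tangent slope in `h1`.
  rw [show q * (1 + poissonMin c x) + (1 - q) * poissonMin (c + 1) x
    = poissonMin (c + 1) x + q * poissonLt (c + 1) x by rw [h2]; ring]
  linarith

/-! ### Sample paths whose transition weights depend on the numbers of sales so far -/

section Paths

variable {α ι : Type*} [DecidableEq ι]

/-- The number of sales of `i` before time `t`, on the path `ω`. -/
def salesBefore {T : ℕ} (buy : α → Option ι) (ω : Fin T → α) (t : Fin T) (i : ι) : ℕ :=
  #{s : Fin T | s < t ∧ buy (ω s) = some i}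

/-- The number of sales of `i` on the path `ω`. -/
def totalSales {T : ℕ} (buy : α → Option ι) (ω : Fin T → α) (i : ι) : ℕ :=
  #{s : Fin T | buy (ω s) = some i}

/-- Weight of a path, when `κ i` units of product `i` have been sold at the start. -/
def pathWeight {T : ℕ} (buy : α → Option ι) (w : Fin T → (ι → ℕ) → α → ℝ) (κ : ι → ℕ)
    (ω : Fin T → α) : ℝ :=
  ∏ t, w t (κ + salesBefore buy ω t) (ω t)

/-- The sales in one step with record `a`. -/
def oneSale (buy : α → Option ι) (a : α) (i : ι) : ℕ := if buy a = some i then 1 else 0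

theorem salesBefore_cons_zero {T : ℕ} (buy : α → Option ι) (a : α) (ω : Fin T → α) :
    salesBefore buy (Fin.cons a ω : Fin (T + 1) → α) 0 = 0 := by
  funext i
  simp [salesBefore]

theorem salesBefore_cons_succ {T : ℕ} (buy : α → Option ι) (a : α) (ω : Fin T → α) (t : Fin T) :
    salesBefore buy (Fin.cons a ω : Fin (T + 1) → α) t.succ =
      oneSale buy a + salesBefore buy ω t := by
  funext i
  simp only [salesBefore, oneSale, Finset.card_filter, Fin.sum_univ_succ, Pi.add_apply,
    Fin.cons_zero, Fin.cons_succ, Fin.succ_lt_succ_iff, Fin.succ_pos, true_and]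

theorem totalSales_cons {T : ℕ} (buy : α → Option ι) (a : α) (ω : Fin T → α) (i : ι) :
    totalSales buy (Fin.cons a ω : Fin (T + 1) → α) i =
      oneSale buy a i + totalSales buy ω i := by
  simp only [totalSales, oneSale, Finset.card_filter, Fin.sum_univ_succ, Fin.cons_zero,
    Fin.cons_succ]

/-- Markov property: after the first record, the rest is a path started from the updated sales. -/
theorem pathWeight_cons {T : ℕ} (buy : α → Option ι) (w : Fin (T + 1) → (ι → ℕ) → α → ℝ)
    (κ : ι → ℕ) (a : α) (ω : Fin T → α) :
    pathWeight buy w κ (Fin.cons a ω : Fin (T + 1) → α) =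
      w 0 κ a * pathWeight buy (fun t => w t.succ) (κ + oneSale buy a) ω := by
  simp only [pathWeight, Fin.prod_univ_succ, salesBefore_cons_zero, salesBefore_cons_succ,
    Fin.cons_zero, Fin.cons_succ, add_zero, add_assoc]

theorem sum_paths_succ [Fintype α] {T : ℕ} (F : (Fin (T + 1) → α) → ℝ) :
    ∑ ω, F ω = ∑ a, ∑ ω : Fin T → α, F (Fin.cons a ω) := by
  rw [← (Fin.consEquiv fun _ : Fin (T + 1) => α).sum_comp, Fintype.sum_prod_type]
  rfl

theorem sum_pathWeight [Fintype α] {T : ℕ} (buy : α → Option ι) (w : Fin T → (ι → ℕ) → α → ℝ)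
    (hw : ∀ t κ, ∑ a, w t κ a = 1) (κ : ι → ℕ) : ∑ ω, pathWeight buy w κ ω = 1 := by
  induction T generalizing κ with
  | zero => simp [pathWeight]
  | succ T ih =>
    rw [sum_paths_succ]
    simp only [pathWeight_cons, ← Finset.mul_sum, ih (fun t => w t.succ) fun t => hw t.succ,
      mul_one, hw]

/-- If, as long as fewer than `c` units of `i` are sold, the next customer `t` buys `i` with
conditional probability at least `p t`, then the expected sales of `i` are at least the expectation
of the minimum of `c` and a Poisson variable of mean `∑ t, p t`. -/
theorem poissonMin_le_sum_pathWeight [Fintype α] {T : ℕ} (buy : α → Option ι)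
    (w : Fin T → (ι → ℕ) → α → ℝ) (hw0 : ∀ t κ a, 0 ≤ w t κ a) (hw : ∀ t κ, ∑ a, w t κ a = 1)
    (i : ι) (c : ℕ) (p : Fin T → ℝ) (hp0 : ∀ t, 0 ≤ p t)
    (hp : ∀ t κ, κ i < c → p t ≤ ∑ a, w t κ a * oneSale buy a i) (κ : ι → ℕ) :
    poissonMin (c - κ i) (∑ t, p t) ≤ ∑ ω, pathWeight buy w κ ω * totalSales buy ω i := by
  induction T generalizing κ with
  | zero => simp [poissonMin_zero, totalSales]
  | succ T ih =>
    rcases Nat.lt_or_ge (κ i) c with hκ | hκ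
    · have hx : 0 ≤ ∑ t : Fin T, p t.succ := Finset.sum_nonneg fun t _ => hp0 t.succ
      have key : ∀ a, w 0 κ a * (oneSale buy a i +
            poissonMin (c - (κ i + oneSale buy a i)) (∑ t : Fin T, p t.succ)) ≤
          ∑ ω : Fin T → α, pathWeight buy w κ (Fin.cons a ω : Fin (T + 1) → α) *
            totalSales buy (Fin.cons a ω : Fin (T + 1) → α) i := fun a => by
        simp only [pathWeight_cons, totalSales_cons, mul_assoc, ← Finset.mul_sum, Nat.cast_add,
          mul_add, Finset.sum_add_distrib]
        rw [← Finset.sum_mul, sum_pathWeight buy (fun t => w t.succ) fun t => hw t.succ, one_mul,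
          ← mul_add]
        have := ih (fun t => w t.succ) (fun t => hw0 t.succ) (fun t => hw t.succ)
          (fun t => p t.succ) (fun t => hp0 t.succ) (fun t => hp t.succ) (κ + oneSale buy a)
        rw [← mul_add]
        exact mul_le_mul_of_nonneg_left (add_le_add le_rfl this) (hw0 _ _ _)
      rw [sum_paths_succ]
      refine le_trans ?_ (Finset.sum_le_sum fun a _ => key a)
      obtain ⟨d, hd⟩ : ∃ d, c - κ i = d + 1 := ⟨c - κ i - 1, by omega⟩
      rw [Fin.sum_univ_succ, hd]
      refine (poissonMin_succ_add_le d hx (hp0 0) (hp 0 κ hκ)).trans_eq ?_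
      -- With total mass one, `1 - q` is also a sum over records, so the identity can be checked
      -- record by record.
      have h1 := hw 0 κ
      rw [← h1, ← Finset.sum_sub_distrib, h1, Finset.sum_mul, Finset.sum_mul,
        ← Finset.sum_add_distrib]
      refine Finset.sum_congr rfl fun a _ => ?_
      unfold oneSale
      split_ifs
      · rw [show c - (κ i + 1) = d by omega]
        push_cast
        ring
      · rw [add_zero, hd]
        push_cast
        ring
    · rw [Nat.sub_eq_zero_of_le hκ]
      simp only [poissonMin, Finset.range_zero, Finset.sum_empty]
      exact Finset.sum_nonneg fun ω _ =>
        mul_nonneg (Finset.prod_nonneg fun t _ => hw0 _ _ _) (Nat.cast_nonneg _)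

end Paths

namespace ChoiceModel

variable {n : ℕ} (φ : ChoiceModel n)

theorem outcomeProb_nonneg (S : Finset (Fin n)) (o : Option (Fin n)) :
    0 ≤ φ.outcomeProb S o := by
  cases o with
  | none => exact sub_nonneg.2 (φ.sum_prob_le_one S)
  | some i => exact φ.prob_nonneg i S

theorem sum_outcomeProb (S : Finset (Fin n)) : ∑ o, φ.outcomeProb S o = 1 := by
  simp [Fintype.sum_option, outcomeProb]

theorem expRevenue_eq_sum (r : Fin n → ℝ) (S : Finset (Fin n)) :
    φ.expRevenue r S = ∑ i, r i * φ.prob i S :=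
  Finset.sum_subset (Finset.subset_univ S) fun i _ hi => by rw [φ.prob_eq_zero i S hi, mul_zero]

end ChoiceModel

namespace PersonalizedAssortmentProblem

variable {n m T : ℕ} (P : PersonalizedAssortmentProblem n m T)

/-! ### Existence of an optimal solution of the linear program -/

/-- Nonnegative weights summing to one lie in the unit box, and all constraints are closed. -/
theorem isCompact_setOf_cdlpFeasible : IsCompact {y | P.CDLPFeasible y} := by
  have hsub : {y | P.CDLPFeasible y} ⊆ Set.Icc 0 1 := fun y hy => by
    refine ⟨fun k S => hy.nonneg k S, fun k S => ?_⟩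
    rw [Pi.one_apply, Pi.one_apply, ← hy.sum_eq_one k]
    exact Finset.single_le_sum (fun S _ => hy.nonneg k S) (Finset.mem_univ S)
  refine isCompact_Icc.of_isClosed_subset ?_ hsub
  have h : {y | P.CDLPFeasible y} =
      {y | ∀ k S, 0 ≤ y k S} ∩ ({y | ∀ k, ∑ S, y k S = 1} ∩ {y | ∀ i,
        (T : ℝ) * ∑ k, P.avgTypeProb k * ∑ S, y k S * (P.choice k).prob i S ≤
          P.inventory i}) :=
    Set.ext fun y => ⟨fun h => ⟨h.1, h.2, h.3⟩, fun h => ⟨h.1, h.2.1, h.2.2⟩⟩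
  rw [h]
  simp only [Set.ofPred_forall]
  refine (isClosed_iInter fun k => isClosed_iInter fun S => ?_).inter
    ((isClosed_iInter fun k => ?_).inter (isClosed_iInter fun i => ?_))
  · exact isClosed_le (by fun_prop) (by fun_prop)
  · exact isClosed_eq (by fun_prop) (by fun_prop)
  · exact isClosed_le (by fun_prop) (by fun_prop)

theorem cdlpFeasible_empty : P.CDLPFeasible fun _ S => if S = ∅ then 1 else 0 where
  nonneg k S := by split_ifs <;> norm_num
  sum_eq_one k := by simp
  inventory_le i := by
    simp [ChoiceModel.prob_eq_zero]

theorem exists_cdlpOptimal : ∃ y, P.CDLPOptimal y := by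
  have hcont : Continuous P.cdlpObjective := by
    unfold cdlpObjective
    fun_prop
  obtain ⟨y, hy, hmax⟩ := P.isCompact_setOf_cdlpFeasible.exists_isMaxOn
    ⟨_, P.cdlpFeasible_empty⟩ hcont.continuousOn
  exact ⟨y, hy, fun y' hy' => hmax hy'⟩

variable {P} {y : Fin m → Finset (Fin n) → ℝ}

theorem CDLPOptimal.cdlpValue_eq (hy : P.CDLPOptimal y) : P.cdlpValue = P.cdlpObjective y :=
  IsGreatest.csSup_eq ⟨⟨y, hy.1, rfl⟩, by rintro _ ⟨y', hy', rfl⟩; exact hy.2 y' hy'⟩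

/-! ### Expected sales of the policy -/

variable (P y)

/-- The probability that customer `t` buys product `i`, if every sampled assortment is offered
without regard to inventory. -/
noncomputable def demandProb (i : Fin n) (t : Fin T) : ℝ :=
  ∑ k, P.typeProb t k * ∑ S, y k S * (P.choice k).prob i S

theorem sum_demandProb (i : Fin n) :
    ∑ t, P.demandProb y i t =
      (T : ℝ) * ∑ k, P.avgTypeProb k * ∑ S, y k S * (P.choice k).prob i S := by
  -- For `T = 0` the averages divide by zero, but both sides vanish.
  rcases Nat.eq_zero_or_pos T with rfl | hT
  · simp
  · have hT' : (T : ℝ) ≠ 0 := by positivity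
    simp only [demandProb, avgTypeProb]
    rw [Finset.sum_comm, Finset.mul_sum]
    refine Finset.sum_congr rfl fun k _ => ?_
    rw [← Finset.sum_mul, ← mul_assoc, mul_div_cancel₀ _ hT']

theorem cdlpObjective_eq_sum :
    P.cdlpObjective y = ∑ i, P.price i * ∑ t, P.demandProb y i t := by
  simp only [sum_demandProb, cdlpObjective, ChoiceModel.expRevenue_eq_sum, Finset.mul_sum]
  rw [Finset.sum_comm (s := (Finset.univ : Finset (Fin n)))]
  refine Finset.sum_congr rfl fun k _ => ?_
  rw [Finset.sum_comm (s := (Finset.univ : Finset (Fin n)))]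
  refine Finset.sum_congr rfl fun S _ => Finset.sum_congr rfl fun i _ => ?_
  ring

/-- Conditional probability of the record `a` of customer `t`, when `κ i` units of each product
`i` have been sold. -/
noncomputable def recordProb (t : Fin T) (κ : Fin n → ℕ) (a : CustomerRecord n m) : ℝ :=
  P.typeProb t a.1 * y a.1 a.2.1 *
    (P.choice a.1).outcomeProb (a.2.1 ∩ ({i | κ i < P.inventory i} : Finset (Fin n))) a.2.2

theorem pathProb_eq_pathWeight (ω : Fin T → CustomerRecord n m) :
    P.pathProb y ω = pathWeight (fun a => a.2.2) (P.recordProb y) 0 ω := by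
  simp only [pathProb, pathWeight, recordProb, zero_add]
  -- Availability depends on the history only through the sales counts.
  rfl

theorem expSales_eq (i : Fin n) :
    P.expSales y i = ∑ ω : Fin T → CustomerRecord n m,
      pathWeight (fun a => a.2.2) (P.recordProb y) 0 ω * totalSales (fun a => a.2.2) ω i := by
  simp only [expSales, pathProb_eq_pathWeight, totalSales]

variable {P y}

theorem recordProb_nonneg (hy : P.CDLPFeasible y) (t : Fin T) (κ : Fin n → ℕ)
    (a : CustomerRecord n m) : 0 ≤ P.recordProb y t κ a :=
  mul_nonneg (mul_nonneg (P.typeProb_nonneg _ _) (hy.nonneg _ _))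
    (ChoiceModel.outcomeProb_nonneg _ _ _)

theorem sum_recordProb (hy : P.CDLPFeasible y) (t : Fin T) (κ : Fin n → ℕ) :
    ∑ a, P.recordProb y t κ a = 1 := by
  simp only [recordProb, Fintype.sum_prod_type, ← Finset.mul_sum, ChoiceModel.sum_outcomeProb,
    mul_one, hy.sum_eq_one, P.sum_typeProb]

theorem demandProb_nonneg (hy : P.CDLPFeasible y) (i : Fin n) (t : Fin T) :
    0 ≤ P.demandProb y i t :=
  Finset.sum_nonneg fun _ _ => mul_nonneg (P.typeProb_nonneg _ _) <|
    Finset.sum_nonneg fun _ _ => mul_nonneg (hy.nonneg _ _) (ChoiceModel.prob_nonneg _ _ _)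

/-- By weak substitutability, an available product is bought with at least its demand
probability. -/
theorem demandProb_le (hP : ∀ k, (P.choice k).WeaklySubstitutable) (hy : P.CDLPFeasible y)
    (i : Fin n) (t : Fin T) (κ : Fin n → ℕ) (hκ : κ i < P.inventory i) :
    P.demandProb y i t ≤
      ∑ a, P.recordProb y t κ a * oneSale (fun a : CustomerRecord n m => a.2.2) a i := by
  have h : ∀ k S, ∑ o, P.recordProb y t κ (k, S, o) *
      (oneSale (fun a : CustomerRecord n m => a.2.2) (k, S, o) i : ℝ) =
        P.typeProb t k * (y k S *
          (P.choice k).prob i (S ∩ ({i | κ i < P.inventory i} : Finset (Fin n)))) := fun k S => by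
    rw [Finset.sum_eq_single (some i)]
    · simp [oneSale, recordProb, ChoiceModel.outcomeProb, mul_assoc]
    · intro o _ ho
      simp [oneSale, ho]
    · simp
  simp only [Fintype.sum_prod_type, h, ← Finset.mul_sum]
  refine Finset.sum_le_sum fun k _ => mul_le_mul_of_nonneg_left ?_ (P.typeProb_nonneg t k)
  refine Finset.sum_le_sum fun S _ => mul_le_mul_of_nonneg_left ?_ (hy.nonneg k S)
  -- If `i ∈ S`, being in stock keeps it in the smaller offered set, so substitutability applies;
  -- otherwise its demand from `S` is zero.
  by_cases hi : i ∈ S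
  · exact hP k _ _ i Finset.inter_subset_left (by simp [hi, hκ])
  · rw [ChoiceModel.prob_eq_zero _ _ _ hi]
    exact ChoiceModel.prob_nonneg _ _ _

theorem le_expSales (hP : ∀ k, (P.choice k).WeaklySubstitutable) (hy : P.CDLPFeasible y)
    (i : Fin n) :
    (1 - 1 / Real.exp 1) * ∑ t, P.demandProb y i t ≤ P.expSales y i := by
  have hle : ∑ t, P.demandProb y i t ≤ P.inventory i := by
    rw [sum_demandProb]
    exact hy.inventory_le i
  have h := poissonMin_le_sum_pathWeight (fun a : CustomerRecord n m => a.2.2) (P.recordProb y)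
    (recordProb_nonneg hy) (sum_recordProb hy) i (P.inventory i) (P.demandProb y i)
    (demandProb_nonneg hy i) (demandProb_le hP hy i) 0
  rw [expSales_eq]
  exact (le_poissonMin _ (Finset.sum_nonneg fun t _ => demandProb_nonneg hy i t) hle).trans h

end PersonalizedAssortmentProblem

theorem mainTheorem7 {n m T : ℕ} (P : PersonalizedAssortmentProblem n m T)
    (hP : ∀ k, (P.choice k).WeaklySubstitutable) :
    (∃ y : Fin m → Finset (Fin n) → ℝ, P.CDLPOptimal y) ∧
      ∀ y : Fin m → Finset (Fin n) → ℝ, P.CDLPOptimal y →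
        (1 - 1 / Real.exp 1) * P.cdlpValue ≤ P.expRevenue y := by
  refine ⟨P.exists_cdlpOptimal, fun y hy => ?_⟩
  -- Optimality enters only here; the sales bound for each product needs just feasibility.
  rw [hy.cdlpValue_eq, P.cdlpObjective_eq_sum y, Finset.mul_sum]
  refine Finset.sum_le_sum fun i _ => ?_
  rw [mul_left_comm]
  exact mul_le_mul_of_nonneg_left
    (PersonalizedAssortmentProblem.le_expSales hP hy.1 i) (P.price_nonneg i)
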